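/- Let $K$ be a field, let $1\le d\le s$ be integers, and let $S=K[t_1,\ldots,t_s]$. Let $I=I_{d,s}\subset S$ be the squarefree Veronese ideal generated by all squarefree monomials of degree $d$ in the $s$ variables. Let $I^\vee$ be its Alexander dual, generated by the monomials $\prod_{i\in C}t_i$ where $C$ runs over the inclusion-minimal subsets of $\{1,\ldots,s\}$ that meet every $d$-element subset of $\{1,\ldots,s\}$. For an ideal $J$ of $S$ let $J^{(n)}=\bigcap_{\mathfrak p}\,(J^nS_{\mathfrak p}\cap S)$, over the minimal primes $\mathfrak p$ of $J$, be its $n$-th symbolic power, and let $\overline{J}$ be its integral closure. Put $$\rho(J)=\sup\{n/r \mid n,r\ge 1,\ J^{(n)}\not\subset J^r\},\qquad \rho_{ic}(J)=\sup\{n/r \mid n,r\ge 1,\ J^{(n)}\not\subset \overline{J^r}\},$$ and, if $J\ne 0$ is generated by squarefree monomials, $\widehat\alpha(J)=\lim_{n\to\infty}\alpha(J^{(n)})/n$, where $\alpha(L)$ is the least degree of a minimal generator of a nonzero monomial ideal $L$. Then the limits $\widehat\alpha(I)$ and $\widehat\alpha(I^\vee)$ exist and $$\rho(I)=\rho_{ic}(I)=\rho_{ic}(I^\vee)=\frac{d(s-d+1)}{s}=\frac{d}{\widehat\alpha(I)}=\frac{s-d+1}{\widehat\alpha(I^\vee)}.$$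 -/

import Mathlib

open Filter Topology

noncomputable section

namespace VeroneseResurgence

/-- A clutter on the vertex set `σ`: a family of finite subsets (edges) of `σ`, none of which is
properly contained in another. -/
structure Clutter (σ : Type*) where
  /-- The set of edges. -/
  edges : Set (Finset σ)
  /-- No edge is contained in a different one. -/
  antichain : IsAntichain (· ⊆ ·) edges

/-- `C` is a vertex cover of the clutter: it meets every edge. -/
def Clutter.IsVertexCover {σ : Type*} (𝒞 : Clutter σ) (C : Finset σ) : Prop :=
  ∀ e ∈ 𝒞.edges, ∃ i ∈ e, i ∈ C

/-- The blocker of a clutter: the clutter of its inclusion-minimal vertex covers. -/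
def Clutter.blocker {σ : Type*} (𝒞 : Clutter σ) : Clutter σ where
  edges := {C | Minimal 𝒞.IsVertexCover C}
  antichain := setOfPred_minimal_antichain 𝒞.IsVertexCover

/-- The edge ideal of a clutter, generated by the squarefree monomials `∏ i ∈ e, t_i`
with `e` an edge. -/
def Clutter.edgeIdeal {σ : Type*} (K : Type*) [Field K] (𝒞 : Clutter σ) :
    Ideal (MvPolynomial σ K) :=
  Ideal.span ((fun e : Finset σ => ∏ i ∈ e, (MvPolynomial.X i : MvPolynomial σ K)) '' 𝒞.edges)

/-- The clutter of all `d`-element subsets of a set with `s` elements. -/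
def uniformClutter (d s : ℕ) : Clutter (Fin s) where
  edges := {e | e.card = d}
  antichain := by
    intro a ha b hb hne hab
    exact hne (Finset.eq_of_subset_of_card_le hab (by
      simp only [Set.mem_ofPred_eq] at ha hb
      omega))

/-- The squarefree Veronese ideal `I_{d,s}`: it is generated by all squarefree monomials of
degree `d` in `s` variables. -/
def sqfreeVeronese (K : Type*) [Field K] (d s : ℕ) : Ideal (MvPolynomial (Fin s) K) :=
  (uniformClutter d s).edgeIdeal K

/-- The Alexander dual of `I_{d,s}`: the edge ideal of the blocker of the clutter whose edge ideal
is `I_{d,s}`. -/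
def sqfreeVeroneseDual (K : Type*) [Field K] (d s : ℕ) : Ideal (MvPolynomial (Fin s) K) :=
  (uniformClutter d s).blocker.edgeIdeal K

/-- The `n`-th symbolic power of `I`: the intersection, over the minimal primes `p` of `I`, of the
contractions to `R` of the ideals `Iⁿ R_p`. -/
def symbolicPower {R : Type*} [CommRing R] (I : Ideal R) (n : ℕ) : Ideal R :=
  ⨅ p : {p : PrimeSpectrum R // p.asIdeal ∈ I.minimalPrimes},
    ((I ^ n).map (algebraMap R (Localization.AtPrime p.1.asIdeal))).comap
      (algebraMap R (Localization.AtPrime p.1.asIdeal))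

/-- `x` is integral over the ideal `J`: it satisfies an equation
`x ^ k + a₁ x ^ (k - 1) + ⋯ + a_k = 0` with `k ≥ 1` and `a_i ∈ J ^ i`. -/
def IsIntegralOverIdeal {R : Type*} [CommRing R] (J : Ideal R) (x : R) : Prop :=
  ∃ k : ℕ, 1 ≤ k ∧ ∃ a : ℕ → R, (∀ i ∈ Finset.Icc 1 k, a i ∈ J ^ i) ∧
    x ^ k + ∑ i ∈ Finset.Icc 1 k, a i * x ^ (k - i) = 0

/-- The integral closure of the ideal `J`, as a subset of the ring. -/
def idealIntegralClosure {R : Type*} [CommRing R] (J : Ideal R) : Set R :=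
  {x | IsIntegralOverIdeal J x}

/-- The resurgence of `I`, `sup {n / r | n, r ≥ 1, I⁽ⁿ⁾ ⊄ Iʳ}`, taken in the extended reals. -/
def resurgence {R : Type*} [CommRing R] (I : Ideal R) : EReal :=
  sSup {q : EReal | ∃ n r : ℕ, 1 ≤ n ∧ 1 ≤ r ∧ ¬ (symbolicPower I n ≤ I ^ r) ∧
    q = (((n : ℝ) / (r : ℝ) : ℝ) : EReal)}

/-- The ic-resurgence of `I`, `sup {n / r | n, r ≥ 1, I⁽ⁿ⁾ ⊄ integral closure of Iʳ}`, taken in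
the extended reals. -/
def icResurgence {R : Type*} [CommRing R] (I : Ideal R) : EReal :=
  sSup {q : EReal | ∃ n r : ℕ, 1 ≤ n ∧ 1 ≤ r ∧
    ¬ ((symbolicPower I n : Set R) ⊆ idealIntegralClosure (I ^ r)) ∧
    q = (((n : ℝ) / (r : ℝ) : ℝ) : EReal)}

/-- The exponents of the minimal monomial generators of a monomial ideal `J`: the exponents of
the monomials in `J` that are minimal with respect to divisibility. -/
def minimalGenerators {σ K : Type*} [Field K] (J : Ideal (MvPolynomial σ K)) : Set (σ →₀ ℕ) :=
  {a | Minimal (fun b : σ →₀ ℕ => MvPolynomial.monomial b (1 : K) ∈ J) a}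

/-- `α(J)`, the least degree of a minimal generator of the (nonzero) monomial ideal `J`. -/
def leastDegree {σ K : Type*} [Field K] (J : Ideal (MvPolynomial σ K)) : ℕ :=
  sInf (Finsupp.degree '' minimalGenerators J)

/-- The sequence `α(I⁽ⁿ⁾) / n`, whose limit is the Waldschmidt constant. -/
def waldschmidtSeq {σ K : Type*} [Field K] (I : Ideal (MvPolynomial σ K)) (n : ℕ) : ℝ :=
  (leastDegree (symbolicPower I n) : ℝ) / (n : ℝ)

/-- The Waldschmidt constant of `I`, the limit of `α(I⁽ⁿ⁾) / n` as `n → ∞`. -/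
def waldschmidtConstant {σ K : Type*} [Field K] (I : Ideal (MvPolynomial σ K)) : ℝ :=
  limUnder atTop (waldschmidtSeq I)

end VeroneseResurgence

end

/-!
Let `c = s - d + 1` and, for an exponent vector `a` and a set `C` of variables, let `a(C)` be the sum
of the `a i` with `i ∈ C`. All ideals involved are monomial, so everything reduces to inequalities
between exponent vectors.

The minimal primes of `I = I_{d,s}` are the ideals generated by the `c`-subsets `C` of the variables,
and locally at such a prime `I` is the prime itself. Hence a monomial `t ^ a` lies in the symbolic
power `I⁽ⁿ⁾` iff `a(C) ≥ n` for all `C` with `|C| = c` (`monomial_mem_symbolicPower_iff`). Powers of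
these primes are described by an order of vanishing: the `n`-th power is the preimage of `(T ^ n)`
under the map `S → S[T]` that multiplies the variables in `C` by `T` (`orderIdeal`). Because `T` is
prime, the order is additive, which takes the place of primary decomposition.

An exchange argument shows that `t ^ a ∈ I ^ r` as soon as `∑ min (a i) r ≥ r d`
(`monomial_mem_sqfreeVeronese_pow`). If this fails while `a(C) ≥ n` for all `c`-subsets, then
averaging over the coordinates below `r` gives `n / r ≤ d c / s` (`mul_le_of_sum_min_lt`), the upper
bound for the resurgence. The ic-resurgence is at most the resurgence. It is at least `d c / s`
because the monomial `(t_1 ⋯ t_s) ^ (d k)` lies in `I⁽ⁿ⁾` for `n = c d k`, but its degree `s d k` is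
too small for the integral closure of `I ^ r` when `r = s k + 1`, and `n / r` tends to `d c / s`
(`le_icResurgence_sqfreeVeronese`).

Averaging and the powers of `t_1 ⋯ t_s` also give `α(I⁽ⁿ⁾) / n → s / c`. Finally, the minimal vertex
covers of the `d`-subsets are the `c`-subsets, so that `I^∨ = I_{c,s}` (`sqfreeVeroneseDual_eq`), and
`d c / s` is symmetric in `c` and `d`.
-/

open Filter Topology

noncomputable section

namespace VeroneseResurgence

open MvPolynomial

/-! ### The order of vanishing along a coordinate subspace -/

section Order

variable {σ K : Type*} [Field K]

lemma mem_of_forall_monomial_mem {J : Ideal (MvPolynomial σ K)} {f : MvPolynomial σ K}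
    (h : ∀ a ∈ f.support, monomial a (1 : K) ∈ J) : f ∈ J := by
  rw [f.as_sum]
  refine J.sum_mem fun a ha => ?_
  rw [← mul_one (coeff a f), ← C_mul_monomial]
  exact J.mul_mem_left _ (h a ha)

lemma prod_X_eq_monomial_indicator [Fintype σ] (e : Finset σ) :
    ∏ i ∈ e, (X i : MvPolynomial σ K) = monomial (Finsupp.indicator e fun _ _ => 1) 1 := by
  rw [monomial_eq, Finsupp.prod_fintype _ _ (by simp), map_one, one_mul,
    ← Finset.prod_subset (Finset.subset_univ e)]
  · exact Finset.prod_congr rfl fun i hi => by simp [Finsupp.indicator_of_mem hi]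
  · intro i _ hi
    simp [Finsupp.indicator_of_notMem hi]

variable [DecidableEq σ]

/-- The homomorphism `S → S[T]` that sends `t_i` to `T t_i` for `i ∈ C` and fixes the other
variables. -/
def scaleHom (K : Type*) [Field K] (C : Finset σ) :
    MvPolynomial σ K →ₐ[K] Polynomial (MvPolynomial σ K) :=
  aeval fun i => Polynomial.X ^ (if i ∈ C then 1 else 0) * Polynomial.C (X i)

lemma scaleHom_monomial [Fintype σ] (C : Finset σ) (a : σ →₀ ℕ) (k : K) :
    scaleHom K C (monomial a k) = Polynomial.monomial (∑ i ∈ C, a i) (monomial a k) := by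
  rw [scaleHom, aeval_monomial, Finsupp.prod_fintype _ _ (by simp)]
  simp only [mul_pow, ← pow_mul, Finset.prod_mul_distrib, Finset.prod_pow_eq_pow_sum]
  rw [← Polynomial.C_mul_X_pow_eq_monomial, monomial_eq, Finsupp.prod_fintype _ _ (by simp)]
  simp only [map_mul, map_prod, map_pow, ite_mul, one_mul, zero_mul, Finset.sum_ite_mem,
    Finset.univ_inter]
  rw [IsScalarTower.algebraMap_apply K (MvPolynomial σ K) (Polynomial (MvPolynomial σ K))]
  simp only [algebraMap_eq, Polynomial.algebraMap_eq]
  ring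

lemma coeff_coeff_scaleHom [Fintype σ] (C : Finset σ) (f : MvPolynomial σ K) (n : ℕ) (a : σ →₀ ℕ) :
    coeff a ((scaleHom K C f).coeff n) = if ∑ i ∈ C, a i = n then coeff a f else 0 := by
  induction f using MvPolynomial.induction_on' with
  | monomial b k =>
    rw [scaleHom_monomial, Polynomial.coeff_monomial]
    by_cases hab : b = a
    · subst hab
      split_ifs <;> simp
    · split_ifs <;> simp [coeff_monomial, hab]
  | add p q hp hq =>
    rw [map_add, Polynomial.coeff_add, coeff_add, hp, hq, coeff_add]
    split_ifs <;> simp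

/-- The polynomials that vanish to order at least `n` along the coordinate subspace where `t_i = 0`
for all `i ∈ C`; this is the `n`-th power of the ideal generated by these variables. -/
def orderIdeal (K : Type*) [Field K] (C : Finset σ) (n : ℕ) : Ideal (MvPolynomial σ K) :=
  (Ideal.span {Polynomial.X ^ n}).comap (scaleHom K C)

lemma mem_orderIdeal {C : Finset σ} {n : ℕ} {f : MvPolynomial σ K} :
    f ∈ orderIdeal K C n ↔ Polynomial.X ^ n ∣ scaleHom K C f := by
  rw [orderIdeal, Ideal.mem_comap, Ideal.mem_span_singleton]

lemma mem_orderIdeal_iff_support [Fintype σ] {C : Finset σ} {n : ℕ} {f : MvPolynomial σ K} :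
    f ∈ orderIdeal K C n ↔ ∀ a ∈ f.support, n ≤ ∑ i ∈ C, a i := by
  rw [mem_orderIdeal, Polynomial.X_pow_dvd_iff]
  constructor
  · intro h a ha
    by_contra! hlt
    have := coeff_coeff_scaleHom C f (∑ i ∈ C, a i) a
    rw [h _ hlt, if_pos rfl, coeff_zero] at this
    exact mem_support_iff.1 ha this.symm
  · intro h m hm
    ext a
    rw [coeff_coeff_scaleHom, coeff_zero]
    split_ifs with hw
    · by_contra hne
      have := h a (mem_support_iff.2 hne)
      omega
    · rfl

lemma monomial_mem_orderIdeal [Fintype σ] {C : Finset σ} {n : ℕ} {a : σ →₀ ℕ} :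
    monomial a (1 : K) ∈ orderIdeal K C n ↔ n ≤ ∑ i ∈ C, a i := by
  simp [mem_orderIdeal_iff_support]

lemma X_mem_orderIdeal_one [Fintype σ] {C : Finset σ} {i : σ} :
    (X i : MvPolynomial σ K) ∈ orderIdeal K C 1 ↔ i ∈ C := by
  rw [X, monomial_mem_orderIdeal]
  simp [Finsupp.single_apply, Nat.one_le_iff_ne_zero]

lemma mul_mem_orderIdeal {C : Finset σ} {m n : ℕ} {f g : MvPolynomial σ K}
    (hf : f ∈ orderIdeal K C m) (hg : g ∈ orderIdeal K C n) : f * g ∈ orderIdeal K C (m + n) := by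
  rw [mem_orderIdeal] at *
  rw [map_mul, pow_add]
  exact mul_dvd_mul hf hg

lemma orderIdeal_anti (C : Finset σ) {m n : ℕ} (h : m ≤ n) :
    orderIdeal K C n ≤ orderIdeal K C m := fun _ hf =>
  mem_orderIdeal.2 ((pow_dvd_pow _ h).trans (mem_orderIdeal.1 hf))

lemma pow_le_orderIdeal {C : Finset σ} {m : ℕ} {J : Ideal (MvPolynomial σ K)}
    (h : J ≤ orderIdeal K C m) (n : ℕ) : J ^ n ≤ orderIdeal K C (m * n) := by
  induction n with
  | zero => intro f _; simp [mem_orderIdeal]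
  | succ n ih =>
    rw [pow_succ, Ideal.mul_le]
    exact fun f hf g hg => mul_mem_orderIdeal (ih hf) (h hg)

instance isPrime_orderIdeal_one (C : Finset σ) : (orderIdeal K C 1).IsPrime := by
  rw [orderIdeal, pow_one]
  have : (Ideal.span {(Polynomial.X : Polynomial (MvPolynomial σ K))}).IsPrime :=
    (Ideal.span_singleton_prime Polynomial.X_ne_zero).2 Polynomial.prime_X
  infer_instance

/-- A factor outside the prime ideal does not change the order of vanishing, because `T` is a
prime element of `S[T]`. -/
lemma mem_orderIdeal_of_mul_mem {C : Finset σ} {n : ℕ} {u f : MvPolynomial σ K}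
    (hu : u ∉ orderIdeal K C 1) (h : u * f ∈ orderIdeal K C n) : f ∈ orderIdeal K C n := by
  rw [mem_orderIdeal] at *
  rw [pow_one] at hu
  rw [map_mul] at h
  exact Polynomial.prime_X.pow_dvd_of_dvd_mul_left n hu h

lemma orderIdeal_one_le [Fintype σ] {C : Finset σ} {J : Ideal (MvPolynomial σ K)}
    (h : ∀ i ∈ C, X i ∈ J) : orderIdeal K C 1 ≤ J := by
  intro f hf
  refine mem_of_forall_monomial_mem fun a ha => ?_
  have h1 := mem_orderIdeal_iff_support.1 hf a ha
  obtain ⟨i, hi, hai⟩ : ∃ i ∈ C, a i ≠ 0 := by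
    by_contra! hall
    rw [Finset.sum_eq_zero hall] at h1
    omega
  exact J.mem_of_dvd ((X_dvd_monomial).2 (Or.inr hai)) (h i hi)

end Order

/-! ### Averaging and exchange for exponent vectors -/

section Exponents

variable {σ : Type*}

/-- Among the `c`-subsets of `T` some subset has at most average weight: discard elements of
largest weight one at a time. -/
lemma exists_subset_card_mul_sum_le [DecidableEq σ] (a : σ → ℕ) {c : ℕ} (T : Finset σ) (hc : c ≤ T.card) :
    ∃ C ⊆ T, C.card = c ∧ T.card * ∑ i ∈ C, a i ≤ c * ∑ i ∈ T, a i := by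
  induction hm : T.card generalizing T with
  | zero => exact ⟨T, subset_rfl, by omega, by simp⟩
  | succ m ih =>
    rcases hc.eq_or_lt with h | h
    · exact ⟨T, subset_rfl, h.symm, by rw [h, hm]⟩
    obtain ⟨j, hj, hmax⟩ := T.exists_max_image a (Finset.card_pos.1 (by omega))
    have hcard : (T.erase j).card = m := by rw [Finset.card_erase_of_mem hj]; omega
    obtain ⟨C, hCT, hCc, hC⟩ := ih (T.erase j) (by omega) hcard
    refine ⟨C, hCT.trans (Finset.erase_subset _ _), hCc, ?_⟩
    have hsum := Finset.add_sum_erase T a hj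
    have hle : ∑ i ∈ T.erase j, a i ≤ m * a j := by
      rw [← hcard, ← smul_eq_mul]
      exact Finset.sum_le_card_nsmul _ _ _ fun i hi => hmax i (Finset.mem_of_mem_erase hi)
    have hCle : ∑ i ∈ C, a i ≤ c * a j := by
      rw [← hCc, ← smul_eq_mul]
      exact Finset.sum_le_card_nsmul _ _ _ fun i hi =>
        hmax i (Finset.mem_of_mem_erase (hCT hi))
    nlinarith

lemma sum_min_ge_of_sum_ge (a : σ → ℕ) (C : Finset σ) {n : ℕ} (h : n ≤ ∑ i ∈ C, a i) :
    n ≤ ∑ i ∈ C, min (a i) n := by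
  by_cases hbig : ∃ i ∈ C, n ≤ a i
  · obtain ⟨i, hi, hn⟩ := hbig
    exact (min_eq_right hn).ge.trans
      (Finset.single_le_sum (f := fun i => min (a i) n) (fun _ _ => Nat.zero_le _) hi)
  · push Not at hbig
    rwa [Finset.sum_congr rfl fun i hi => min_eq_left (hbig i hi).le]

/-- The exchange step for squarefree Veronese powers: an exponent vector that is large enough for
the `(r + 1)`-st power is divisible by a generator with quotient large enough for the `r`-th power.
The generator takes the coordinates exceeding `r` first. -/
lemma exists_card_eq_sum_min_tsub [Fintype σ] [DecidableEq σ] (a : σ → ℕ) {d r : ℕ}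
    (h : (r + 1) * d ≤ ∑ i, min (a i) (r + 1)) :
    ∃ e : Finset σ, e.card = d ∧ (∀ i ∈ e, 1 ≤ a i) ∧
      r * d ≤ ∑ i, min (a i - if i ∈ e then 1 else 0) r := by
  set T : Finset σ := Finset.univ.filter fun i => r + 1 ≤ a i with hT
  set V : Finset σ := Finset.univ.filter fun i => 1 ≤ a i with hV
  have hTV : T ⊆ V := fun i hi => by
    simp only [hT, hV, Finset.mem_filter, Finset.mem_univ, true_and] at *
    omega
  have hVcard : d ≤ V.card := by
    have : ∑ i, min (a i) (r + 1) ≤ (r + 1) * V.card := by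
      rw [hV, Finset.card_filter, Finset.mul_sum]
      refine Finset.sum_le_sum fun i _ => ?_
      split_ifs
      · simp
      · omega
    exact Nat.le_of_mul_le_mul_left (h.trans this) (Nat.succ_pos r)
  rcases le_total d T.card with hd | hd
  · obtain ⟨e, heT, hed⟩ := Finset.exists_subset_card_eq hd
    refine ⟨e, hed, fun i hi => (Finset.mem_filter.1 (hTV (heT hi))).2, ?_⟩
    calc r * d ≤ r * T.card := Nat.mul_le_mul_left _ hd
      _ = ∑ i, r * if r + 1 ≤ a i then 1 else 0 := by
        rw [hT, Finset.card_filter, Finset.mul_sum]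
      _ ≤ _ := Finset.sum_le_sum fun i _ => by split_ifs <;> simp <;> omega
  · obtain ⟨e, hTe, heV, hed⟩ := Finset.exists_subsuperset_card_eq hTV hd hVcard
    refine ⟨e, hed, fun i hi => (Finset.mem_filter.1 (heV hi)).2, ?_⟩
    have hsum : ∑ i, min (a i) (r + 1) ≤
        ∑ i, (min (a i - if i ∈ e then 1 else 0) r + if i ∈ e then 1 else 0) := by
      refine Finset.sum_le_sum fun i _ => ?_
      have hi : r + 1 ≤ a i → i ∈ e := fun hi => hTe (Finset.mem_filter.2 ⟨Finset.mem_univ i, hi⟩)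
      split_ifs with hie
      · omega
      · have : a i ≤ r := by
          by_contra! hlt
          exact hie (hi hlt)
        omega
    rw [Finset.sum_add_distrib, Finset.sum_ite_mem, Finset.univ_inter, Finset.sum_const,
      smul_eq_mul, mul_one, hed] at hsum
    nlinarith

/-- If all `(s - d + 1)`-subsets have weight at least `n`, but the truncation at `r` has total
weight less than `r d`, then `n / r ≤ d (s - d + 1) / s`. Fewer than `d` coordinates reach `r`; the
bound comes from averaging over the remaining ones. -/
lemma mul_le_of_sum_min_lt [Fintype σ] [DecidableEq σ] (a : σ → ℕ) {d c n r : ℕ}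
    (hc : c + d = Fintype.card σ + 1) (hd : d ≤ Fintype.card σ)
    (hn : ∀ C : Finset σ, C.card = c → n ≤ ∑ i ∈ C, a i)
    (hr : ∑ i, min (a i) r < r * d) : n * Fintype.card σ ≤ d * c * r := by
  set s := Fintype.card σ
  set B : Finset σ := Finset.univ.filter fun i => r ≤ a i with hB
  have hsplit : ∑ i, min (a i) r = r * B.card + ∑ i ∈ Bᶜ, a i := by
    rw [← Finset.sum_add_sum_compl B]
    congr 1
    · rw [Finset.sum_congr rfl (g := fun _ => r) fun i hi => min_eq_right (Finset.mem_filter.1 hi).2,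
        Finset.sum_const, smul_eq_mul, mul_comm]
    · refine Finset.sum_congr rfl fun i hi => min_eq_left ?_
      simp only [hB, Finset.mem_compl, Finset.mem_filter, Finset.mem_univ, true_and] at hi
      omega
  have hBd : B.card < d := by
    by_contra! hle
    have := Nat.mul_le_mul_left r hle
    omega
  have hBc : Bᶜ.card = s - B.card := Finset.card_compl B
  obtain ⟨C, -, hCc, hC⟩ := exists_subset_card_mul_sum_le a (c := c) Bᶜ (by omega)
  obtain ⟨m, hm⟩ : ∃ m, s = B.card + m := ⟨s - B.card, by omega⟩
  obtain ⟨l, hl⟩ : ∃ l, d = B.card + l := ⟨d - B.card, by omega⟩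
  have hBm : Bᶜ.card = m := by omega
  have hlm : l ≤ m := by omega
  have hmpos : 0 < m := by omega
  rw [hBm] at hC
  have h1 : m * n ≤ m * ∑ i ∈ C, a i := Nat.mul_le_mul_left _ (hn C hCc)
  have h2 : ∑ i ∈ Bᶜ, a i ≤ r * l := by
    rw [hsplit, hl, mul_add] at hr
    omega
  have h3 : m * n ≤ c * (r * l) := h1.trans (hC.trans (Nat.mul_le_mul_left _ h2))
  -- `l / m ≤ d / s`, since `d = |B| + l`, `s = |B| + m` and `l ≤ m`
  have h4 : l * s ≤ m * d := by
    rw [hm, hl]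
    nlinarith
  refine Nat.le_of_mul_le_mul_left (c := m) ?_ hmpos
  calc m * (n * s) = (m * n) * s := by ring
    _ ≤ c * (r * l) * s := Nat.mul_le_mul_right _ h3
    _ = c * r * (l * s) := by ring
    _ ≤ c * r * (m * d) := Nat.mul_le_mul_left _ h4
    _ = m * (d * c * r) := by ring

end Exponents

/-! ### Powers and symbolic powers of squarefree Veronese ideals -/

section Veronese

variable {K : Type*} [Field K] {d s c : ℕ}

lemma prod_X_mem_sqfreeVeronese {e : Finset (Fin s)} (he : e.card = d) :
    ∏ i ∈ e, (X i : MvPolynomial (Fin s) K) ∈ sqfreeVeronese K d s :=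
  Ideal.subset_span ⟨e, he, rfl⟩

lemma sqfreeVeronese_le_orderIdeal (C : Finset (Fin s)) {m : ℕ} (h : m + s ≤ C.card + d) :
    sqfreeVeronese K d s ≤ orderIdeal K C m := by
  rw [sqfreeVeronese, Clutter.edgeIdeal, Ideal.span_le]
  rintro _ ⟨e, he, rfl⟩
  change e.card = d at he
  simp only [SetLike.mem_coe]
  rw [prod_X_eq_monomial_indicator, monomial_mem_orderIdeal]
  simp only [Finsupp.indicator_apply, dite_eq_ite, Finset.sum_ite_mem, Finset.sum_const,
    smul_eq_mul, mul_one]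
  have h1 := Finset.card_union_add_card_inter C e
  have h2 := Finset.card_le_univ (C ∪ e)
  rw [Fintype.card_fin] at h2
  omega

/-- The powers of `I` are polymatroidal: a monomial lies in `I ^ r` as soon as its truncation at
`r` has degree at least `r d`. -/
lemma monomial_mem_sqfreeVeronese_pow (r : ℕ) (a : Fin s →₀ ℕ)
    (h : r * d ≤ ∑ i, min (a i) r) : monomial a (1 : K) ∈ sqfreeVeronese K d s ^ r := by
  induction r generalizing a with
  | zero => simp
  | succ r ih =>
    obtain ⟨e, hed, hea, hsum⟩ := exists_card_eq_sum_min_tsub a h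
    set b : Fin s →₀ ℕ := Finsupp.indicator e fun _ _ => 1 with hb
    have hbi : ∀ i, b i = if i ∈ e then 1 else 0 := fun i => by
      rw [hb, Finsupp.indicator_apply, dite_eq_ite]
    have hba : b ≤ a := fun i => by
      rw [hbi]
      split_ifs with hi
      · exact hea i hi
      · exact Nat.zero_le _
    have hab : a = (a - b) + b := (tsub_add_cancel_of_le hba).symm
    rw [hab, ← one_mul (1 : K), ← monomial_mul, pow_succ]
    refine Ideal.mul_mem_mul (ih _ ?_) ?_
    · simpa only [Finsupp.tsub_apply, hbi] using hsum
    · rw [hb, ← prod_X_eq_monomial_indicator]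
      exact prod_X_mem_sqfreeVeronese hed

lemma orderIdeal_one_mem_minimalPrimes (hc : c + d = s + 1) {C : Finset (Fin s)}
    (hC : C.card = c) : orderIdeal K C 1 ∈ (sqfreeVeronese K d s).minimalPrimes := by
  refine ⟨⟨inferInstance, sqfreeVeronese_le_orderIdeal C (by omega)⟩, ?_⟩
  rintro Q ⟨hQ, hIQ⟩ hQC
  refine orderIdeal_one_le fun i hi => ?_
  have hcard : (insert i Cᶜ).card = d := by
    rw [Finset.card_insert_of_notMem (by simpa using hi), Finset.card_compl, Fintype.card_fin]
    have := Finset.card_pos.2 ⟨i, hi⟩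
    have := Finset.card_le_univ C
    rw [Fintype.card_fin] at this
    omega
  obtain ⟨j, hj, hjQ⟩ := (hQ.prod_mem_iff).1 (hIQ (prod_X_mem_sqfreeVeronese hcard))
  have hjC : j ∈ C := X_mem_orderIdeal_one.1 (hQC hjQ)
  rcases Finset.mem_insert.1 hj with rfl | hj
  · exact hjQ
  · exact absurd hjC (Finset.mem_compl.1 hj)

lemma exists_eq_orderIdeal_one_of_mem_minimalPrimes (hc : c + d = s + 1)
    {P : Ideal (MvPolynomial (Fin s) K)} (hP : P ∈ (sqfreeVeronese K d s).minimalPrimes) :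
    ∃ C : Finset (Fin s), C.card = c ∧ P = orderIdeal K C 1 := by
  classical
  have hprime : P.IsPrime := hP.1.1
  set D : Finset (Fin s) := Finset.univ.filter fun i => (X i : MvPolynomial (Fin s) K) ∈ P with hD
  have hDc : c ≤ D.card := by
    by_contra! hlt
    have hcompl : Dᶜ.card = s - D.card := by rw [Finset.card_compl, Fintype.card_fin]
    obtain ⟨e, heD, hed⟩ := Finset.exists_subset_card_eq (s := Dᶜ) (n := d) (by omega)
    obtain ⟨j, hj, hjP⟩ := (hprime.prod_mem_iff).1 (hP.1.2 (prod_X_mem_sqfreeVeronese hed))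
    exact Finset.mem_compl.1 (heD hj) (by simp [hD, hjP])
  obtain ⟨C, hCD, hCc⟩ := Finset.exists_subset_card_eq hDc
  have hle : orderIdeal K C 1 ≤ P :=
    orderIdeal_one_le fun i hi => (Finset.mem_filter.1 (hCD hi)).2
  exact ⟨C, hCc, le_antisymm
    (hP.2 ⟨inferInstance, sqfreeVeronese_le_orderIdeal C (by omega)⟩ hle) hle⟩

lemma mem_symbolicPower_iff {R : Type*} [CommRing R] {I : Ideal R} {n : ℕ} {f : R} :
    f ∈ symbolicPower I n ↔ ∀ P ∈ I.minimalPrimes, ∃ u ∉ P, u * f ∈ I ^ n := by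
  simp only [symbolicPower, Ideal.mem_iInf, Ideal.mem_comap]
  constructor
  · intro h P hP
    have := hP.1.1
    obtain ⟨u, hu, huf⟩ := (IsLocalization.algebraMap_mem_map_algebraMap_iff P.primeCompl _ _ _).1
      (h ⟨⟨P, hP.1.1⟩, hP⟩)
    exact ⟨u, hu, huf⟩
  · rintro h ⟨P, hP⟩
    obtain ⟨u, hu, huf⟩ := h _ hP
    exact (IsLocalization.algebraMap_mem_map_algebraMap_iff P.asIdeal.primeCompl _ _ _).2
      ⟨u, hu, huf⟩

lemma symbolicPower_le_orderIdeal (hc : c + d = s + 1) {C : Finset (Fin s)} (hC : C.card = c)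
    (n : ℕ) : symbolicPower (sqfreeVeronese K d s) n ≤ orderIdeal K C n := by
  intro f hf
  obtain ⟨u, hu, huf⟩ := mem_symbolicPower_iff.1 hf _ (orderIdeal_one_mem_minimalPrimes hc hC)
  have hle := pow_le_orderIdeal (sqfreeVeronese_le_orderIdeal (K := K) (d := d) C (m := 1)
    (by omega)) n
  rw [one_mul] at hle
  exact mem_orderIdeal_of_mul_mem hu (hle huf)

lemma monomial_mem_symbolicPower_iff (hc : c + d = s + 1) (hd : 1 ≤ d) {n : ℕ}
    {a : Fin s →₀ ℕ} : monomial a (1 : K) ∈ symbolicPower (sqfreeVeronese K d s) n ↔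
      ∀ C : Finset (Fin s), C.card = c → n ≤ ∑ i ∈ C, a i := by
  refine ⟨fun h C hC => monomial_mem_orderIdeal.1 (symbolicPower_le_orderIdeal hc hC n h),
    fun h => mem_symbolicPower_iff.2 fun P hP => ?_⟩
  obtain ⟨C, hCc, rfl⟩ := exists_eq_orderIdeal_one_of_mem_minimalPrimes hc hP
  -- the product of the variables outside `C` is a unit at the prime of `C`
  set b : Fin s →₀ ℕ := Finsupp.indicator Cᶜ fun _ _ => n with hb
  have hbC : ∀ i ∈ C, b i = 0 := fun i hi => by
    rw [hb, Finsupp.indicator_of_notMem (by simpa using hi)]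
  have hbCc : ∀ i ∈ Cᶜ, b i = n := fun i hi => by
    rw [hb, Finsupp.indicator_of_mem hi]
  refine ⟨monomial b 1, ?_, ?_⟩
  · rw [monomial_mem_orderIdeal, Finset.sum_eq_zero hbC]
    omega
  · rw [monomial_mul, one_mul]
    refine monomial_mem_sqfreeVeronese_pow n _ ?_
    rw [← Finset.sum_add_sum_compl C]
    have h1 : n ≤ ∑ i ∈ C, min ((b + a) i) n :=
      sum_min_ge_of_sum_ge _ _ ((h C hCc).trans (Finset.sum_le_sum fun i _ => by simp))
    have h2 : ∑ i ∈ Cᶜ, min ((b + a) i) n = (s - c) * n := by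
      rw [Finset.sum_congr rfl (g := fun _ => n) fun i hi => by
        simp [hbCc i hi], Finset.sum_const, Finset.card_compl, hCc, Fintype.card_fin, smul_eq_mul]
    obtain ⟨k, rfl⟩ : ∃ k, d = k + 1 := ⟨d - 1, by omega⟩
    have hk : s - c = k := by omega
    rw [h2, hk]
    nlinarith

/-! ### The resurgence and the ic-resurgence -/

lemma subset_idealIntegralClosure {R : Type*} [CommRing R] (J : Ideal R) :
    (J : Set R) ⊆ idealIntegralClosure J := by
  intro x hx
  refine ⟨1, le_rfl, fun _ => -x, fun i hi => ?_, by simp⟩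
  obtain rfl : i = 1 := by simpa using hi
  simpa using hx

lemma icResurgence_le_resurgence {R : Type*} [CommRing R] (I : Ideal R) :
    icResurgence I ≤ resurgence I := by
  refine sSup_le_sSup ?_
  rintro q ⟨n, r, hn, hr, hnot, rfl⟩
  exact ⟨n, r, hn, hr, fun h => hnot fun x hx => subset_idealIntegralClosure _ (h hx), rfl⟩

lemma resurgence_sqfreeVeronese_le (hc : c + d = s + 1) (hds : d ≤ s) (hs : 0 < s) :
    resurgence (sqfreeVeronese K d s) ≤ (((d : ℝ) * c / s : ℝ) : EReal) := by
  refine sSup_le ?_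
  rintro q ⟨n, r, hn, hr, hnot, rfl⟩
  rw [EReal.coe_le_coe_iff, div_le_div_iff₀ (by exact_mod_cast hr) (by exact_mod_cast hs)]
  by_contra hlt
  refine hnot fun f hf => mem_of_forall_monomial_mem fun a ha =>
    monomial_mem_sqfreeVeronese_pow r a ?_
  by_contra! hsum
  refine hlt ?_
  have := mul_le_of_sum_min_lt a (n := n) (r := r) (by simpa using hc) (by simpa using hds)
    (fun C hC => mem_orderIdeal_iff_support.1 (symbolicPower_le_orderIdeal hc hC n hf) a ha) hsum
  rw [Fintype.card_fin] at this
  exact_mod_cast this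

/-- If `J` vanishes to order at least `m` along a coordinate subspace, then so does every monomial
in its integral closure. -/
lemma le_sum_of_isIntegralOverIdeal {σ : Type*} [Fintype σ] [DecidableEq σ] {C : Finset σ} {m : ℕ}
    {J : Ideal (MvPolynomial σ K)} (hJ : J ≤ orderIdeal K C m) {a : σ →₀ ℕ}
    (ha : IsIntegralOverIdeal J (monomial a (1 : K))) : m ≤ ∑ i ∈ C, a i := by
  obtain ⟨k, hk, b, hb, heq⟩ := ha
  by_contra! hlt
  set w := ∑ i ∈ C, a i with hw
  have hpow : ∀ j, monomial a (1 : K) ^ j ∈ orderIdeal K C (w * j) := fun j => by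
    rw [monomial_pow, one_pow, monomial_mem_orderIdeal]
    simp only [Finsupp.smul_apply, smul_eq_mul, ← Finset.mul_sum]
    rw [hw, mul_comm]
  -- every summand but the leading one has order greater than `w k`
  have hmem : monomial a (1 : K) ^ k ∈ orderIdeal K C (w * k + 1) := by
    rw [eq_neg_of_add_eq_zero_left heq]
    refine neg_mem (Ideal.sum_mem _ fun i hi => ?_)
    refine orderIdeal_anti C ?_ (mul_mem_orderIdeal (pow_le_orderIdeal hJ i (hb i hi)) (hpow _))
    obtain ⟨h1, h2⟩ := Finset.mem_Icc.1 hi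
    obtain ⟨l, rfl⟩ := Nat.exists_eq_add_of_le h2
    rw [Nat.add_sub_cancel_left]
    nlinarith
  rw [monomial_pow, one_pow, monomial_mem_orderIdeal] at hmem
  simp only [Finsupp.smul_apply, smul_eq_mul, ← Finset.mul_sum] at hmem
  rw [← hw, mul_comm] at hmem
  omega

lemma sum_const_fin (k : ℕ) (C : Finset (Fin s)) :
    ∑ i ∈ C, (Finsupp.equivFunOnFinite.symm fun _ : Fin s => k) i = C.card * k := by
  simp

lemma le_icResurgence_sqfreeVeronese (hc : c + d = s + 1) (hd : 1 ≤ d) (hds : d ≤ s) :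
    (((d : ℝ) * c / s : ℝ) : EReal) ≤ icResurgence (sqfreeVeronese K d s) := by
  have hs : (s : ℝ) ≠ 0 := by
    have : s ≠ 0 := by omega
    exact_mod_cast this
  -- powers of the product of all variables show that the ratios `c d k / (s k + 1)` occur
  have hle : ∀ᶠ k : ℕ in atTop, (((d * c : ℝ) / (s + 1 / (k : ℝ)) : ℝ) : EReal) ≤
      icResurgence (sqfreeVeronese K d s) := by
    filter_upwards [eventually_ge_atTop 1] with k hk
    refine le_sSup ⟨c * (d * k), s * k + 1, ?_, by omega, fun hsub => ?_, ?_⟩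
    · exact Nat.mul_pos (by omega) (Nat.mul_pos (by omega) (by omega))
    · have hmem := hsub ((monomial_mem_symbolicPower_iff hc hd
        (a := Finsupp.equivFunOnFinite.symm fun _ : Fin s => d * k)).2
        fun C hC => by rw [sum_const_fin, hC])
      have hle := le_sum_of_isIntegralOverIdeal (pow_le_orderIdeal
        (sqfreeVeronese_le_orderIdeal (Finset.univ) (m := d) (by simp [add_comm])) _) hmem
      rw [sum_const_fin, Finset.card_univ, Fintype.card_fin] at hle
      nlinarith
    · have hk' : (k : ℝ) ≠ 0 := by
        have : k ≠ 0 := by omega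
        exact_mod_cast this
      congr 1
      push_cast
      have h1 : (s : ℝ) + 1 / k = (s * k + 1) / k := by field_simp
      rw [h1, div_div_eq_mul_div]
      ring
  refine le_of_tendsto (f := fun k : ℕ => (((d * c : ℝ) / (s + 1 / (k : ℝ)) : ℝ) : EReal))
    (x := atTop) ?_ hle
  refine (continuous_coe_real_ereal.tendsto _).comp ?_
  refine tendsto_const_nhds.div ?_ hs
  simpa using tendsto_const_nhds.add (tendsto_one_div_atTop_nhds_zero_nat (𝕜 := ℝ))

lemma resurgence_sqfreeVeronese (hc : c + d = s + 1) (hd : 1 ≤ d) (hds : d ≤ s) :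
    resurgence (sqfreeVeronese K d s) = (((d : ℝ) * c / s : ℝ) : EReal) :=
  le_antisymm (resurgence_sqfreeVeronese_le hc hds (by omega))
    ((le_icResurgence_sqfreeVeronese hc hd hds).trans (icResurgence_le_resurgence _))

lemma icResurgence_sqfreeVeronese (hc : c + d = s + 1) (hd : 1 ≤ d) (hds : d ≤ s) :
    icResurgence (sqfreeVeronese K d s) = (((d : ℝ) * c / s : ℝ) : EReal) :=
  le_antisymm ((icResurgence_le_resurgence _).trans
    (resurgence_sqfreeVeronese_le hc hds (by omega))) (le_icResurgence_sqfreeVeronese hc hd hds)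

/-! ### The Waldschmidt constant -/

lemma leastDegree_le_degree {σ : Type*} {J : Ideal (MvPolynomial σ K)} {a : σ →₀ ℕ}
    (ha : monomial a (1 : K) ∈ J) : leastDegree J ≤ a.degree := by
  obtain ⟨b, hba, hb⟩ := exists_minimal_le_of_wellFoundedLT
    (fun b : σ →₀ ℕ => monomial b (1 : K) ∈ J) a ha
  have hmem : b.degree ∈ Finsupp.degree '' minimalGenerators J := ⟨b, hb, rfl⟩
  exact (Nat.sInf_le hmem).trans (Finsupp.degree_mono hba)

lemma exists_degree_eq_leastDegree {σ : Type*} {J : Ideal (MvPolynomial σ K)} {a : σ →₀ ℕ}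
    (ha : monomial a (1 : K) ∈ J) : ∃ b, monomial b (1 : K) ∈ J ∧ b.degree = leastDegree J := by
  obtain ⟨b, -, hb⟩ := exists_minimal_le_of_wellFoundedLT
    (fun b : σ →₀ ℕ => monomial b (1 : K) ∈ J) a ha
  have hne : (Finsupp.degree '' minimalGenerators J).Nonempty := ⟨_, b, hb, rfl⟩
  obtain ⟨b', hb', hdeg⟩ := Nat.sInf_mem hne
  exact ⟨b', hb'.1, hdeg⟩

lemma leastDegree_symbolicPower_bounds (hc : c + d = s + 1) (hd : 1 ≤ d) (hds : d ≤ s) (n : ℕ) :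
    s * n ≤ c * leastDegree (symbolicPower (sqfreeVeronese K d s) n) ∧
      leastDegree (symbolicPower (sqfreeVeronese K d s) n) ≤ s * (n / c + 1) := by
  have hmem : monomial (Finsupp.equivFunOnFinite.symm fun _ : Fin s => n / c + 1) (1 : K) ∈
      symbolicPower (sqfreeVeronese K d s) n :=
    (monomial_mem_symbolicPower_iff hc hd).2 fun C hC => by
      rw [sum_const_fin, hC]
      exact (Nat.lt_mul_div_succ n (by omega)).le
  constructor
  · obtain ⟨b, hb, hdeg⟩ := exists_degree_eq_leastDegree hmem
    obtain ⟨C, -, hCc, hC⟩ := exists_subset_card_mul_sum_le b (c := c) Finset.univ (by simp; omega)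
    rw [← hdeg, Finsupp.degree_eq_sum]
    rw [Finset.card_univ, Fintype.card_fin] at hC
    exact (Nat.mul_le_mul_left s ((monomial_mem_symbolicPower_iff hc hd).1 hb C hCc)).trans hC
  · refine (leastDegree_le_degree hmem).trans ?_
    rw [Finsupp.degree_eq_sum, sum_const_fin, Finset.card_univ, Fintype.card_fin]

lemma tendsto_waldschmidtSeq_sqfreeVeronese (hc : c + d = s + 1) (hd : 1 ≤ d) (hds : d ≤ s) :
    Tendsto (waldschmidtSeq (sqfreeVeronese K d s)) atTop (𝓝 ((s : ℝ) / c)) := by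
  have hc0 : (0 : ℝ) < c := by
    have : 0 < c := by omega
    exact_mod_cast this
  have hupper : Tendsto (fun n : ℕ => (s : ℝ) / c + s * (1 / (n : ℝ))) atTop (𝓝 ((s : ℝ) / c)) := by
    simpa using tendsto_const_nhds.add
      ((tendsto_one_div_atTop_nhds_zero_nat (𝕜 := ℝ)).const_mul (s : ℝ))
  refine tendsto_of_tendsto_of_tendsto_of_le_of_le' tendsto_const_nhds hupper ?_ ?_
  all_goals
    filter_upwards [eventually_ge_atTop 1] with n hn
    have hn0 : (0 : ℝ) < n := by exact_mod_cast hn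
    obtain ⟨h1, h2⟩ := leastDegree_symbolicPower_bounds (K := K) hc hd hds n
    rw [waldschmidtSeq]
  · rw [div_le_div_iff₀ hc0 hn0, mul_comm _ (c : ℝ)]
    exact_mod_cast h1
  · have h3 : (leastDegree (symbolicPower (sqfreeVeronese K d s) n) : ℝ) ≤ s * (n / c + 1) :=
      calc _ ≤ (s : ℝ) * ((n / c : ℕ) + 1) := by exact_mod_cast h2
        _ ≤ _ := by gcongr; exact Nat.cast_div_le
    rw [div_le_iff₀ hn0]
    refine h3.trans (le_of_eq ?_)
    field_simp

lemma waldschmidtConstant_sqfreeVeronese (hc : c + d = s + 1) (hd : 1 ≤ d) (hds : d ≤ s) :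
    waldschmidtConstant (sqfreeVeronese K d s) = (s : ℝ) / c :=
  (tendsto_waldschmidtSeq_sqfreeVeronese hc hd hds).limUnder_eq

/-! ### The Alexander dual -/

lemma isVertexCover_uniformClutter_iff (hc : c + d = s + 1) (C : Finset (Fin s)) :
    (uniformClutter d s).IsVertexCover C ↔ c ≤ C.card := by
  have hcompl : Cᶜ.card = s - C.card := by rw [Finset.card_compl, Fintype.card_fin]
  constructor
  · intro h
    by_contra! hlt
    obtain ⟨e, heC, hed⟩ := Finset.exists_subset_card_eq (s := Cᶜ) (n := d) (by omega)
    obtain ⟨i, hie, hiC⟩ := h e hed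
    exact Finset.mem_compl.1 (heC hie) hiC
  · intro h e he
    change e.card = d at he
    by_contra! hdisj
    have := Finset.card_le_card fun i hi => Finset.mem_compl.2 (hdisj i hi)
    have := Finset.card_le_univ C
    rw [Fintype.card_fin] at this
    omega

lemma sqfreeVeroneseDual_eq (hc : c + d = s + 1) :
    sqfreeVeroneseDual K d s = sqfreeVeronese K c s := by
  have hedges : (uniformClutter d s).blocker.edges = (uniformClutter c s).edges := by
    ext C
    change Minimal (uniformClutter d s).IsVertexCover C ↔ C.card = c
    constructor
    · intro h
      have hle := (isVertexCover_uniformClutter_iff hc C).1 h.1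
      obtain ⟨B, hBC, hB⟩ := Finset.exists_subset_card_eq hle
      have := Finset.card_le_card (h.2 ((isVertexCover_uniformClutter_iff hc B).2 hB.ge) hBC)
      omega
    · intro h
      refine ⟨(isVertexCover_uniformClutter_iff hc C).2 h.ge, fun B hB hBC => ?_⟩
      have := (isVertexCover_uniformClutter_iff hc B).1 hB
      exact (Finset.eq_of_subset_of_card_le hBC (by omega)).ge
  rw [sqfreeVeroneseDual, sqfreeVeronese, Clutter.edgeIdeal, Clutter.edgeIdeal, hedges]

end Veronese

end VeroneseResurgence

end

open VeroneseResurgence in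
theorem mainTheorem3 (K : Type*) [Field K] (d s : ℕ) (hd : 1 ≤ d) (hds : d ≤ s) :
    resurgence (sqfreeVeronese K d s) = (((d : ℝ) * ((s : ℝ) - d + 1) / s : ℝ) : EReal) ∧
    icResurgence (sqfreeVeronese K d s) = (((d : ℝ) * ((s : ℝ) - d + 1) / s : ℝ) : EReal) ∧
    icResurgence (sqfreeVeroneseDual K d s) = (((d : ℝ) * ((s : ℝ) - d + 1) / s : ℝ) : EReal) ∧
    Tendsto (waldschmidtSeq (sqfreeVeronese K d s)) atTop
      (𝓝 (waldschmidtConstant (sqfreeVeronese K d s))) ∧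
    (d : ℝ) * ((s : ℝ) - d + 1) / s = (d : ℝ) / waldschmidtConstant (sqfreeVeronese K d s) ∧
    Tendsto (waldschmidtSeq (sqfreeVeroneseDual K d s)) atTop
      (𝓝 (waldschmidtConstant (sqfreeVeroneseDual K d s))) ∧
    (d : ℝ) * ((s : ℝ) - d + 1) / s =
      ((s : ℝ) - d + 1) / waldschmidtConstant (sqfreeVeroneseDual K d s) := by
  obtain ⟨c, hc⟩ : ∃ c, c + d = s + 1 := ⟨s + 1 - d, by omega⟩
  have hc' : d + c = s + 1 := by omega
  have hc1 : 1 ≤ c := by omega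
  have hcs : c ≤ s := by omega
  have hcast : (s : ℝ) - d + 1 = c := by
    have : (c : ℝ) + d = s + 1 := by exact_mod_cast hc
    linarith
  rw [hcast, sqfreeVeroneseDual_eq hc, waldschmidtConstant_sqfreeVeronese hc hd hds,
    waldschmidtConstant_sqfreeVeronese hc' hc1 hcs]
  refine ⟨resurgence_sqfreeVeronese hc hd hds, icResurgence_sqfreeVeronese hc hd hds, ?_,
    tendsto_waldschmidtSeq_sqfreeVeronese hc hd hds, (div_div_eq_mul_div _ _ _).symm,
    tendsto_waldschmidtSeq_sqfreeVeronese hc' hc1 hcs, ?_⟩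
  · rw [icResurgence_sqfreeVeronese hc' hc1 hcs, mul_comm]
  · rw [div_div_eq_mul_div, mul_comm]
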